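/- Let $L$ be a finite distributive lattice with least element $\hat 0$ and rank function $r$ (so $r(x)$ is the length of any maximal chain in the interval $[\hat 0,x]$), and for $x\in L$ let $m(x)$ be the number of maximal chains in $[\hat 0,x]$. Let $\mathbb{R}^+=\{a\in\mathbb{R}: a\ge 0\}$, let $\mu:L\to\mathbb{R}^+$ be log-supermodular, i.e. $\mu(x)\mu(y)\le\mu(x\wedge y)\,\mu(x\vee y)$ for all $x,y\in L$, and let $0\le s\le t$ be real numbers. For $k:L\to\mathbb{R}^+$ define the polynomial $$E(k;q)=\sum_{x\in L}k(x)\,\mu(x)\,m(x)^t\,\frac{q^{r(x)}}{(r(x)!)^s}\in\mathbb{R}^+[q].$$ For $p,p'\in\mathbb{R}[q]$ write $p\ll p'$ if all coefficients of $p'-p$ are nonnegative. Let $g,h:L\to\mathbb{R}^+$. If $g$ and $h$ are comonotone (both increasing or both decreasing, in the weak sense), then $$E(g;q)\cdot E(h;q)\ \ll\ E(1;q)\cdot E(gh;q).$$ If $g$ and $h$ are countermonotone (one increasing and the other decreasing, in the weak sense), then the inequality is reversed: $$E(1;q)\cdot E(gh;q)\ \ll\ E(g;q)\cdot E(h;q).$$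 -/

import Mathlib

open Polynomial

noncomputable section

namespace QFKG

/-- `μ(x) μ(y) ≤ μ(x ∧ y) μ(x ∨ y)` for all `x, y`. -/
def LogSupermodular {L : Type*} [Lattice L] (μ : L → ℝ) : Prop :=
  ∀ x y : L, μ x * μ y ≤ μ (x ⊓ y) * μ (x ⊔ y)

/-- Both functions are increasing, or both are decreasing. -/
def Comonotone {L : Type*} [Preorder L] (g h : L → ℝ) : Prop :=
  (Monotone g ∧ Monotone h) ∨ (Antitone g ∧ Antitone h)

/-- One function is increasing and the other one is decreasing. -/
def Countermonotone {L : Type*} [Preorder L] (g h : L → ℝ) : Prop :=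
  (Monotone g ∧ Antitone h) ∨ (Antitone g ∧ Monotone h)

/-- The rank `r(x)`: the maximal length of a chain with top element `x`. The value of
`Order.height` is finite in a finite order, and in a finite distributive lattice
all maximal chains of `[0̂, x]` have this length. -/
def rank {L : Type*} [Preorder L] (x : L) : ℕ :=
  (Order.height x).toNat

/-- The number `m(x)` of maximal chains (flags) of the interval `[0̂, x] = {y | y ≤ x}`. -/
def numMaxChains {L : Type*} [Preorder L] (x : L) : ℕ :=
  Nat.card (Flag (Set.Iic x))

/-- The polynomial `E(k; q) = ∑ x, k(x) μ(x) m(x)^t q^{r(x)} / (r(x)!)^s`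
(real powers `t` and `s`). -/
def E {L : Type*} [Preorder L] [Fintype L] (μ : L → ℝ) (s t : ℝ) (k : L → ℝ) : ℝ[X] :=
  ∑ x : L, C (k x * μ x * (numMaxChains x : ℝ) ^ t / ((rank x).factorial : ℝ) ^ s) * X ^ rank x

/-- The coefficientwise order `p ≪ p'`: all coefficients of `p' - p` are nonnegative. -/
def CoeffLE (p p' : ℝ[X]) : Prop :=
  ∀ n : ℕ, 0 ≤ (p' - p).coeff n

end QFKG

end

/-! The coefficient of `q^n` in a product of two polynomials `E` is a sum over pairs of total rank
`n`. Rank is modular, so these pairs split into fibers of fixed meet and join, and a four functions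
inequality on each fiber suffices (`sum_fiber_le`). A fiber is a sublattice of `L × Lᵒᵈ`, where the
four functions theorem yields the square of the desired inequality.

The weight must then be log-supermodular. It equals `μ * (m / r!)^s * m^(t - s)`, with both
exponents nonnegative. For `m / r!` this is Fishburn's inequality: the number of `n`-multichains
below `x` is log-supermodular in `x` by induction on `n`, and divided by `n^r(x)` it tends to `m(x)
/ r(x)!`. Log-convexity of the factorial transfers the property to `m`. Monotonicity of `g` and `h`
enters only through pointwise bounds such as `g x * h y ≤ (g * h) (x ⊔ y)`. -/

noncomputable section

namespace QFKG

open scoped FinsetFamily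

/-! ### Four functions inequality at fixed meet and join -/

section FourFunctions

variable {L : Type*} [DistribLattice L] [Fintype L]

open Classical in
/-- The pairs with prescribed meet and join. -/
def fiber (a b : L) : Finset (L × L) := {p | p.1 ⊓ p.2 = a ∧ p.1 ⊔ p.2 = b}

/-- Closure of a fiber under the meet of `L × Lᵒᵈ`; exchanging the coordinates gives closure under
the join. -/
lemma inf_exchange {L : Type*} [DistribLattice L] {a b x y z w : L}
    (h₁ : x ⊓ y = a) (h₂ : x ⊔ y = b) (h₃ : z ⊓ w = a)
    (h₄ : z ⊔ w = b) : (x ⊓ z) ⊓ (y ⊔ w) = a ∧ (x ⊓ z) ⊔ (y ⊔ w) = b := by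
  have hz : a ≤ z := h₃ ▸ inf_le_left
  have hx : a ≤ x := h₁ ▸ inf_le_left
  have hy : y ≤ b := h₂ ▸ le_sup_right
  have hw : w ≤ b := h₄ ▸ le_sup_right
  constructor
  · have e₁ : x ⊓ z ⊓ y = a := by rw [inf_right_comm, h₁, inf_eq_left.2 hz]
    have e₂ : x ⊓ z ⊓ w = a := by rw [inf_assoc, h₃, inf_eq_right.2 hx]
    rw [inf_sup_left, e₁, e₂, sup_idem]
  · have e₁ : x ⊔ (y ⊔ w) = b := by rw [← sup_assoc, h₂, sup_eq_left.2 hw]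
    have e₂ : z ⊔ (y ⊔ w) = b := by rw [sup_left_comm, h₄, sup_eq_right.2 hy]
    rw [sup_inf_right, e₁, e₂, inf_idem]

/-- The four functions inequality for the pairs with prescribed meet and join. -/
lemma sum_fiber_le {α β γ δ : L → ℝ} (hα : 0 ≤ α) (hβ : 0 ≤ β) (hγ : 0 ≤ γ) (hδ : 0 ≤ δ)
    (h : ∀ x y, α x * β y ≤ γ (x ⊓ y) * δ (x ⊔ y)) (a b : L) :
    ∑ p ∈ fiber a b, α p.1 * β p.2 ≤ ∑ p ∈ fiber a b, γ p.1 * δ p.2 := by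
  classical
  let φ : L × L ≃ L × Lᵒᵈ := (Equiv.refl L).prodCongr OrderDual.toDual
  let S : Finset (L × Lᵒᵈ) := (fiber a b).map φ.toEmbedding
  have hS : ∀ p : L × Lᵒᵈ,
      p ∈ S ↔ p.1 ⊓ OrderDual.ofDual p.2 = a ∧ p.1 ⊔ OrderDual.ofDual p.2 = b := by
    intro p
    simp only [S, Finset.mem_map_equiv, fiber, Finset.mem_filter, Finset.mem_univ, true_and]
    rfl
  -- The second and fourth functions have their coordinates swapped. Fibers are symmetric, so each
  -- side becomes the square of a fiber sum.
  have key := four_functions_theorem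
    (fun p : L × Lᵒᵈ => α p.1 * β (OrderDual.ofDual p.2))
    (fun p => α (OrderDual.ofDual p.2) * β p.1)
    (fun p => γ p.1 * δ (OrderDual.ofDual p.2))
    (fun p => γ (OrderDual.ofDual p.2) * δ p.1)
    (fun p => mul_nonneg (hα _) (hβ _)) (fun p => mul_nonneg (hα _) (hβ _))
    (fun p => mul_nonneg (hγ _) (hδ _)) (fun p => mul_nonneg (hγ _) (hδ _))
    (fun p q => by
      have e₁ := h p.1 q.1
      have e₂ := h (OrderDual.ofDual q.2) (OrderDual.ofDual p.2)
      have := mul_le_mul e₁ e₂ (mul_nonneg (hα _) (hβ _)) (mul_nonneg (hγ _) (hδ _))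
      have c₁ : OrderDual.ofDual (p ⊓ q).2
          = OrderDual.ofDual q.2 ⊔ OrderDual.ofDual p.2 := sup_comm _ _
      have c₂ : OrderDual.ofDual (p ⊔ q).2
          = OrderDual.ofDual q.2 ⊓ OrderDual.ofDual p.2 := inf_comm _ _
      simp only [c₁, c₂, Prod.fst_inf, Prod.fst_sup]
      linarith) S S
  have hinf : S ⊼ S ⊆ S := by
    intro p hp
    obtain ⟨u, hu, v, hv, rfl⟩ := Finset.mem_infs.1 hp
    rw [hS] at hu hv ⊢
    exact inf_exchange hu.1 hu.2 hv.1 hv.2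
  have hsup : S ⊻ S ⊆ S := by
    intro p hp
    obtain ⟨u, hu, v, hv, rfl⟩ := Finset.mem_sups.1 hp
    rw [hS] at hu hv ⊢
    have := inf_exchange (x := OrderDual.ofDual u.2) (y := u.1) (z := OrderDual.ofDual v.2)
      (w := v.1) (inf_comm u.1 _ ▸ hu.1) (sup_comm u.1 _ ▸ hu.2) (inf_comm v.1 _ ▸ hv.1)
      (sup_comm v.1 _ ▸ hv.2)
    exact ⟨(inf_comm _ _).trans this.1, (sup_comm _ _).trans this.2⟩
  have swap : ∀ f k : L → ℝ, ∑ p ∈ S, f (OrderDual.ofDual p.2) * k p.1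
      = ∑ p ∈ fiber a b, f p.1 * k p.2 := by
    intro f k
    simp only [S, Finset.sum_map]
    refine Finset.sum_nbij' Prod.swap Prod.swap ?_ ?_ ?_ ?_ ?_
    · intro p hp
      simp only [fiber, Finset.mem_filter, Finset.mem_univ, true_and, Prod.fst_swap,
        Prod.snd_swap] at hp ⊢
      rwa [inf_comm, sup_comm]
    · intro p hp
      simp only [fiber, Finset.mem_filter, Finset.mem_univ, true_and, Prod.fst_swap,
        Prod.snd_swap] at hp ⊢
      rwa [inf_comm, sup_comm]
    · intro p _; simp
    · intro p _; simp
    · intro p _; rfl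
  have noswap : ∀ f k : L → ℝ, ∑ p ∈ S, f p.1 * k (OrderDual.ofDual p.2)
      = ∑ p ∈ fiber a b, f p.1 * k p.2 := by
    intro f k
    simp only [S, Finset.sum_map]
    rfl
  have le₁ := Finset.sum_le_sum_of_subset_of_nonneg hinf
    (f := fun p : L × Lᵒᵈ => γ p.1 * δ (OrderDual.ofDual p.2))
    (fun p _ _ => mul_nonneg (hγ _) (hδ _))
  have le₂ := Finset.sum_le_sum_of_subset_of_nonneg hsup
    (f := fun p : L × Lᵒᵈ => γ (OrderDual.ofDual p.2) * δ p.1)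
    (fun p _ _ => mul_nonneg (hγ _) (hδ _))
  have key' := key.trans (mul_le_mul le₁ le₂
    (Finset.sum_nonneg fun p _ => mul_nonneg (hγ _) (hδ _))
    (Finset.sum_nonneg fun p _ => mul_nonneg (hγ _) (hδ _)))
  rw [swap, noswap, swap, noswap] at key'
  exact (mul_self_le_mul_self_iff
    (Finset.sum_nonneg fun p _ => mul_nonneg (hα p.1) (hβ p.2))
    (Finset.sum_nonneg fun p _ => mul_nonneg (hγ p.1) (hδ p.2))).2 key'

/-- The four functions inequality for the pairs with prescribed total rank. -/
lemma sum_rank_eq_le {r : L → ℕ} (hr : ∀ x y, r x + r y = r (x ⊓ y) + r (x ⊔ y))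
    {α β γ δ : L → ℝ} (hα : 0 ≤ α) (hβ : 0 ≤ β) (hγ : 0 ≤ γ) (hδ : 0 ≤ δ)
    (h : ∀ x y, α x * β y ≤ γ (x ⊓ y) * δ (x ⊔ y)) (n : ℕ) :
    ∑ p : L × L, (if r p.1 + r p.2 = n then α p.1 * β p.2 else 0)
      ≤ ∑ p : L × L, (if r p.1 + r p.2 = n then γ p.1 * δ p.2 else 0) := by
  classical
  have split : ∀ f : L × L → ℝ, ∑ p : L × L, (if r p.1 + r p.2 = n then f p else 0)
      = ∑ c : L × L, if r c.1 + r c.2 = n then ∑ p ∈ fiber c.1 c.2, f p else 0 := by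
    intro f
    rw [← Finset.sum_fiberwise Finset.univ (fun p : L × L => (p.1 ⊓ p.2, p.1 ⊔ p.2))]
    refine Finset.sum_congr rfl fun c _ => ?_
    have hc : (Finset.univ.filter fun p : L × L => (p.1 ⊓ p.2, p.1 ⊔ p.2) = c)
        = fiber c.1 c.2 := by
      ext p
      simp [fiber, Prod.ext_iff]
    rw [hc, ← Finset.sum_const_zero (s := fiber c.1 c.2), ← Finset.sum_ite_irrel]
    refine Finset.sum_congr rfl fun p hp => ?_
    simp only [fiber, Finset.mem_filter, Finset.mem_univ, true_and] at hp
    rw [hr p.1 p.2, hp.1, hp.2, Finset.sum_const_zero]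
  rw [split fun p => α p.1 * β p.2, split fun p => γ p.1 * δ p.2]
  refine Finset.sum_le_sum fun c _ => ?_
  split_ifs
  · exact sum_fiber_le hα hβ hγ hδ h _ _
  · exact le_rfl

end FourFunctions

/-! ### Multichain counts and Fishburn's inequality -/

section Multichains

variable {L : Type*}

open Classical in
/-- The number of multichains of length `n` in `{y | y ≤ x}`. -/
def multichainCount [Preorder L] [Fintype L] : ℕ → L → ℕ
  | 0, _ => 1
  | n + 1, x => ∑ y with y ≤ x, multichainCount n y

open Classical in
/-- The number of strict chains of length `n` in `{y | y < x}`. -/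
def chainCount [Preorder L] [Fintype L] : ℕ → L → ℕ
  | 0, _ => 1
  | n + 1, x => ∑ y with y < x, chainCount n y

lemma multichainCount_mul_le [DistribLattice L] [Fintype L] (n : ℕ) (x y : L) :
    multichainCount n x * multichainCount n y
      ≤ multichainCount n (x ⊓ y) * multichainCount n (x ⊔ y) := by
  classical
  induction n generalizing x y with
  | zero => simp [multichainCount]
  | succ n ih =>
    simp only [multichainCount]
    refine (four_functions_theorem (multichainCount n) (multichainCount n) (multichainCount n)
      (multichainCount n) (fun _ => Nat.zero_le _) (fun _ => Nat.zero_le _) (fun _ => Nat.zero_le _)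
      (fun _ => Nat.zero_le _) ih _ _).trans ?_
    refine Nat.mul_le_mul (Finset.sum_le_sum_of_subset ?_) (Finset.sum_le_sum_of_subset ?_)
    · intro z hz
      obtain ⟨u, hu, v, hv, rfl⟩ := Finset.mem_infs.1 hz
      simp only [Finset.mem_filter, Finset.mem_univ, true_and] at hu hv ⊢
      exact inf_le_inf hu hv
    · intro z hz
      obtain ⟨u, hu, v, hv, rfl⟩ := Finset.mem_sups.1 hz
      simp only [Finset.mem_filter, Finset.mem_univ, true_and] at hu hv ⊢
      exact sup_le_sup hu hv

open Classical in
lemma chainCount_eq_zero [Preorder L] [Fintype L] {r : L → ℕ} (hr : StrictMono r) {k : ℕ} {x : L}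
    (h : r x < k) : chainCount k x = 0 := by
  induction k generalizing x with
  | zero => omega
  | succ k ih =>
    refine Finset.sum_eq_zero fun y hy => ih ?_
    have := hr (Finset.mem_filter.1 hy).2
    omega

-- Choose which `k` of the `n` weak steps descending from `x` are strict. The bound `N` is uniform
-- in `x` so that the induction can exchange sums.
open Classical in
lemma multichainCount_eq_sum [PartialOrder L] [Fintype L] {r : L → ℕ} (hr : StrictMono r) {N : ℕ}
    (hN : ∀ x, r x ≤ N) (n : ℕ) (x : L) :
    multichainCount n x = ∑ k ∈ Finset.range (N + 1), n.choose k * chainCount k x := by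
  induction n generalizing x with
  | zero =>
    rw [Finset.sum_range_succ']
    simp [multichainCount, chainCount]
  | succ n ih =>
    have hsplit : (Finset.univ.filter fun y => y ≤ x)
        = insert x (Finset.univ.filter fun y => y < x) := by
      ext y
      simp [le_iff_eq_or_lt]
    -- Summing over `y < x` shifts the chain length by one; the overflow term vanishes, so the range
    -- can stop at `N`.
    have hlast : chainCount (N + 1) x = 0 := chainCount_eq_zero hr (Nat.lt_succ_of_le (hN x))
    have hstep : ∑ y with y < x, multichainCount n y
        = ∑ k ∈ Finset.range N, n.choose k * chainCount (k + 1) x := by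
      simp_rw [ih]
      rw [Finset.sum_comm, ← add_zero (∑ k ∈ Finset.range N, _), ← mul_zero (n.choose N), ← hlast,
        ← Finset.sum_range_succ fun k => n.choose k * chainCount (k + 1) x]
      refine Finset.sum_congr rfl fun k _ => ?_
      rw [chainCount, Finset.mul_sum]
    have : multichainCount (n + 1) x
        = multichainCount n x + ∑ y with y < x, multichainCount n y := by
      rw [multichainCount, hsplit, Finset.sum_insert (by simp)]
    rw [this, hstep, ih, Finset.sum_range_succ', Finset.sum_range_succ']
    simp only [Nat.choose_succ_succ, add_mul, Finset.sum_add_distrib, Nat.choose_zero_right]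
    ring

open Filter Topology in
lemma tendsto_choose_div_pow {k r : ℕ} (h : k ≤ r) :
    Tendsto (fun n : ℕ => (n.choose k : ℝ) / (n : ℝ) ^ r) atTop
      (𝓝 (if k = r then 1 / (r.factorial : ℝ) else 0)) := by
  have hk : Tendsto (fun n : ℕ => (n.choose k : ℝ) / (n : ℝ) ^ k) atTop
      (𝓝 (1 / (k.factorial : ℝ))) := by
    have hv : ∀ᶠ n : ℕ in atTop, ((n : ℝ) ^ k / k.factorial) ≠ 0 := by
      filter_upwards [eventually_gt_atTop 0] with n hn
      positivity
    have := (Asymptotics.isEquivalent_iff_tendsto_one hv).1 (isEquivalent_choose k)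
    have := this.mul_const (1 / (k.factorial : ℝ))
    rw [one_mul] at this
    refine this.congr' ?_
    filter_upwards [eventually_gt_atTop 0] with n hn
    simp only [Pi.div_apply]
    field_simp
  split_ifs with hkr
  · exact hkr ▸ hk
  · have hpow : Tendsto (fun n : ℕ => ((n : ℝ) ^ (r - k))⁻¹) atTop (𝓝 0) :=
      ((tendsto_pow_atTop (by omega)).comp tendsto_natCast_atTop_atTop).inv_tendsto_atTop
    have := hk.mul hpow
    rw [mul_zero] at this
    refine this.congr fun n => ?_
    rw [div_mul_eq_mul_div, ← div_eq_mul_inv, div_div, ← pow_add]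
    congr 2
    omega

-- As a function of `n` the count is a polynomial of degree at most `r x`; the limit is its
-- coefficient of `n ^ r x`.
open Filter Topology in
lemma tendsto_multichainCount [PartialOrder L] [Fintype L] {r : L → ℕ} (hr : StrictMono r)
    (x : L) :
    Tendsto (fun n : ℕ => (multichainCount n x : ℝ) / (n : ℝ) ^ r x) atTop
      (𝓝 ((chainCount (r x) x : ℝ) / (r x).factorial)) := by
  classical
  obtain ⟨N, hN⟩ : ∃ N, ∀ y, r y ≤ N :=
    ⟨Finset.univ.sup r, fun y => Finset.le_sup (Finset.mem_univ y)⟩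
  have hterm : ∀ k ∈ Finset.range (N + 1), Tendsto
      (fun n : ℕ => (n.choose k : ℝ) / (n : ℝ) ^ r x * (chainCount k x : ℝ)) atTop
      (𝓝 ((if k = r x then 1 / ((r x).factorial : ℝ) else 0) * (chainCount k x : ℝ))) := by
    intro k _
    rcases le_or_gt k (r x) with h | h
    · exact (tendsto_choose_div_pow h).mul_const _
    · simp [chainCount_eq_zero hr h]
  have := tendsto_finsetSum _ hterm
  have hsum : ∑ k ∈ Finset.range (N + 1),
      (if k = r x then 1 / ((r x).factorial : ℝ) else 0) * (chainCount k x : ℝ)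
        = (chainCount (r x) x : ℝ) / (r x).factorial := by
    simp only [ite_mul, zero_mul, Finset.sum_ite_eq', Finset.mem_range]
    rw [if_pos (Nat.lt_succ_of_le (hN x)), one_div_mul_eq_div]
  rw [hsum] at this
  refine this.congr fun n => ?_
  rw [multichainCount_eq_sum hr hN n x]
  push_cast
  rw [Finset.sum_div]
  exact Finset.sum_congr rfl fun k _ => by ring

/-- Fishburn's inequality, for a modular strictly monotone rank function. -/
lemma chainCount_div_factorial_mul_le [DistribLattice L] [Fintype L] {r : L → ℕ}
    (hr : StrictMono r) (hmod : ∀ x y, r x + r y = r (x ⊓ y) + r (x ⊔ y)) (x y : L) :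
    (chainCount (r x) x : ℝ) / (r x).factorial * ((chainCount (r y) y : ℝ) / (r y).factorial)
      ≤ (chainCount (r (x ⊓ y)) (x ⊓ y) : ℝ) / (r (x ⊓ y)).factorial
        * ((chainCount (r (x ⊔ y)) (x ⊔ y) : ℝ) / (r (x ⊔ y)).factorial) := by
  refine le_of_tendsto_of_tendsto'
    ((tendsto_multichainCount hr x).mul (tendsto_multichainCount hr y))
    ((tendsto_multichainCount hr (x ⊓ y)).mul (tendsto_multichainCount hr (x ⊔ y))) fun n => ?_
  -- By modularity both sides are divided by the same power of `n`.
  rw [div_mul_div_comm, div_mul_div_comm, ← pow_add, ← pow_add, hmod]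
  refine div_le_div_of_nonneg_right ?_ (by positivity)
  exact_mod_cast multichainCount_mul_le n x y

end Multichains

/-! ### Rank as the number of join-primes below an element -/

section Rank

variable {L : Type*} [DistribLattice L] [Fintype L]

open Classical in
/-- The number of join-prime elements below `x`. -/
def primeCount (x : L) : ℕ := (Finset.univ.filter fun p : L => SupPrime p ∧ p ≤ x).card

lemma primeCount_modular (x y : L) :
    primeCount x + primeCount y = primeCount (x ⊓ y) + primeCount (x ⊔ y) := by
  classical
  unfold primeCount
  rw [← Finset.card_union_add_card_inter, add_comm]
  congr 2
  · ext p
    simp only [Finset.mem_inter, Finset.mem_filter, Finset.mem_univ, true_and, le_inf_iff]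
    tauto
  · ext p
    simp only [Finset.mem_union, Finset.mem_filter, Finset.mem_univ, true_and]
    constructor
    · rintro (⟨hp, h⟩ | ⟨hp, h⟩)
      exacts [⟨hp, hp.le_sup.2 (Or.inl h)⟩, ⟨hp, hp.le_sup.2 (Or.inr h)⟩]
    · rintro ⟨hp, h⟩
      exact (hp.le_sup.1 h).imp (⟨hp, ·⟩) (⟨hp, ·⟩)

/-- `y` is a join of join-irreducibles, which are prime by distributivity; they cannot all lie below
`x`. -/
lemma exists_supPrime_le_not_le {x y : L} (h : ¬ y ≤ x) : ∃ p, SupPrime p ∧ p ≤ y ∧ ¬ p ≤ x := by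
  classical
  have : Nonempty L := ⟨x⟩
  let _ : OrderBot L := Fintype.toOrderBot L
  obtain ⟨s, hs, hirr⟩ := exists_supIrred_decomposition y
  by_contra! hcon
  refine h (hs ▸ Finset.sup_le fun p hp => ?_)
  exact hcon p (supPrime_iff_supIrred.2 (hirr hp)) (hs ▸ Finset.le_sup (f := id) hp)

lemma primeCount_strictMono : StrictMono (primeCount : L → ℕ) := by
  classical
  intro x y hxy
  obtain ⟨p, hp, hpy, hpx⟩ := exists_supPrime_le_not_le hxy.not_ge
  refine Finset.card_lt_card (Finset.ssubset_iff_of_subset ?_ |>.2 ⟨p, ?_, ?_⟩)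
  · intro q hq
    simp only [Finset.mem_filter, Finset.mem_univ, true_and] at hq ⊢
    exact ⟨hq.1, hq.2.trans hxy.le⟩
  · exact Finset.mem_filter.2 ⟨Finset.mem_univ _, hp, hpy⟩
  · simp [hpx]

lemma primeCount_of_covBy {x y : L} (h : x ⋖ y) : primeCount y = primeCount x + 1 := by
  classical
  obtain ⟨p, hp, hpy, hpx⟩ := exists_supPrime_le_not_le h.lt.not_ge
  -- Adjoining any new prime `p` to `x` already gives `y`, so every other new prime lies below `p`;
  -- by symmetry there is only one.
  have key : ∀ {p q : L}, SupPrime q → p ≤ y → ¬ p ≤ x → q ≤ y → ¬ q ≤ x → q ≤ p := by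
    intro p q hq hpy hpx hqy hqx
    have : x ⊔ p = y := 
      (h.eq_or_eq le_sup_left (sup_le h.le hpy)).resolve_left fun e => hpx (e ▸ le_sup_right)
    exact (hq.le_sup.1 (this.symm ▸ hqy)).resolve_left hqx
  unfold primeCount
  rw [← Finset.card_insert_of_notMem (a := p) (by simp [hpx])]
  congr 1
  ext q
  simp only [Finset.mem_insert, Finset.mem_filter, Finset.mem_univ, true_and]
  constructor
  · rintro ⟨hq, hqy⟩
    by_cases hqx : q ≤ x
    · exact Or.inr ⟨hq, hqx⟩
    · exact Or.inl (le_antisymm (key hq hpy hpx hqy hqx) (key hp hqy hqx hpy hpx))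
  · rintro (rfl | ⟨hq, hqx⟩)
    exacts [⟨hp, hpy⟩, ⟨hq, hqx.trans h.le⟩]

lemma primeCount_of_isMin {x : L} (h : IsMin x) : primeCount x = 0 := by
  classical
  refine Finset.card_eq_zero.2 (Finset.filter_eq_empty_iff.2 ?_)
  rintro p - ⟨hp, hpx⟩
  exact hp.1 (h.mono hpx)

lemma exists_covBy_of_not_isMin {x : L} (h : ¬ IsMin x) : ∃ y, y ⋖ x := by
  obtain ⟨z, hz⟩ := not_isMin_iff.1 h
  obtain ⟨y, -, hy⟩ := exists_le_covBy_of_lt hz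
  exact ⟨y, hy⟩

lemma height_eq_primeCount (x : L) : Order.height x = primeCount x := by
  induction x using WellFoundedLT.induction with
  | ind x ih =>
    refine le_antisymm (Order.height_le_coe_iff.2 fun y hy => ?_) ?_
    · rw [ih y hy]
      exact_mod_cast primeCount_strictMono hy
    · by_cases h : IsMin x
      · simp [primeCount_of_isMin h]
      · obtain ⟨y, hy⟩ := exists_covBy_of_not_isMin h
        rw [primeCount_of_covBy hy]
        push_cast
        rw [← ih y hy.lt]
        exact Order.height_add_one_le hy.lt

lemma rank_eq_primeCount (x : L) : rank x = primeCount x := by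
  rw [rank, height_eq_primeCount, ENat.toNat_natCast]

lemma rank_modular (x y : L) : rank x + rank y = rank (x ⊓ y) + rank (x ⊔ y) := by
  simpa only [rank_eq_primeCount] using primeCount_modular x y

lemma rank_strictMono : StrictMono (rank : L → ℕ) := fun x y h => by
  simpa only [rank_eq_primeCount] using primeCount_strictMono h

lemma rank_of_covBy {x y : L} (h : x ⋖ y) : rank y = rank x + 1 := by
  simpa only [rank_eq_primeCount] using primeCount_of_covBy h

lemma rank_of_isMin {x : L} (h : IsMin x) : rank x = 0 := by
  rw [rank_eq_primeCount, primeCount_of_isMin h]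

end Rank

/-! ### Recursion for maximal chains -/

section Flags

variable {L : Type*} [PartialOrder L]

/-- The maximal chains of `{y | y ≤ x}`, as sets of elements of `L`. -/
def maxChains (x : L) : Set (Set L) :=
  {s | s ⊆ Set.Iic x ∧ IsChain (· ≤ ·) s ∧ ∀ y ≤ x, (∀ z ∈ s, y ≤ z ∨ z ≤ y) → y ∈ s}

/-- Realizing flags as subsets of `L` lets chains of different intervals be compared. -/
lemma numMaxChains_eq_ncard (x : L) : numMaxChains x = (maxChains x).ncard := by
  rw [numMaxChains, ← Nat.card_coe_set_eq]
  refine Nat.card_congr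
    { toFun := fun F => ⟨Subtype.val '' (F : Set (Set.Iic x)), ?_, ?_, ?_⟩
      invFun := fun s => ⟨Subtype.val ⁻¹' (s : Set L), ?_, ?_⟩
      left_inv := ?_
      right_inv := ?_ }
  · rintro _ ⟨y, -, rfl⟩
    exact y.2
  · rintro _ ⟨y, hy, rfl⟩ _ ⟨z, hz, rfl⟩ -
    exact F.le_or_le hy hz
  · intro y hy h
    refine ⟨⟨y, hy⟩, ?_, rfl⟩
    exact Flag.mem_iff_forall_le_or_ge.2 fun z hz => h z ⟨z, hz, rfl⟩
  · intro y hy z hz _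
    exact s.2.2.1.total hy hz
  · intro t ht hst
    refine hst.antisymm fun y hy => s.2.2.2 y y.2 fun z hz => ?_
    exact ht.total hy (hst (show (⟨z, s.2.1 hz⟩ : Set.Iic x) ∈ Subtype.val ⁻¹' (s : Set L) from hz))
  · intro F
    apply Flag.ext
    exact Set.preimage_image_eq _ Subtype.val_injective
  · intro s
    apply Subtype.ext
    exact Subtype.image_preimage_val _ _ |>.trans (Set.inter_eq_right.2 s.2.1)

lemma top_mem_of_mem_maxChains {x : L} {s : Set L} (hs : s ∈ maxChains x) : x ∈ s :=
  hs.2.2 x le_rfl fun _ hz => Or.inr (hs.1 hz)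

lemma maxChains_of_isMin {x : L} (h : IsMin x) : maxChains x = {{x}} := by
  ext s
  simp only [Set.mem_singleton_iff]
  constructor
  · intro hs
    refine Set.eq_singleton_iff_unique_mem.2 ⟨top_mem_of_mem_maxChains hs, fun y hy => ?_⟩
    exact h.eq_of_le (hs.1 hy)
  · rintro rfl
    refine ⟨by simp, by simp, fun y hy _ => ?_⟩
    exact h.eq_of_le hy

lemma insert_mem_maxChains {x y : L} (h : y ⋖ x) {s : Set L} (hs : s ∈ maxChains y) :
    insert x s ∈ maxChains x := by
  refine ⟨?_, ?_, ?_⟩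
  · rintro z (rfl | hz)
    exacts [le_rfl, (hs.1 hz).trans h.le]
  · exact hs.2.1.insert fun z hz _ => Or.inr ((hs.1 hz).trans h.le)
  · intro z hz hcomp
    rcases hcomp y (Or.inr (top_mem_of_mem_maxChains hs)) with hzy | hyz
    · exact Or.inr (hs.2.2 z hzy fun w hw => hcomp w (Or.inr hw))
    · rcases h.eq_or_eq hyz hz with rfl | rfl
      exacts [Or.inr (top_mem_of_mem_maxChains hs), Or.inl rfl]

lemma notMem_of_mem_maxChains {x y : L} (h : y < x) {s : Set L} (hs : s ∈ maxChains y) :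
    x ∉ s := fun hx => h.not_ge (hs.1 hx)

lemma exists_eq_insert_of_mem_maxChains [Finite L] {x : L} (hx : ¬ IsMin x) {s : Set L}
    (hs : s ∈ maxChains x) : ∃ y, y ⋖ x ∧ ∃ u ∈ maxChains y, insert x u = s := by
  have hxs := top_mem_of_mem_maxChains hs
  obtain ⟨z, hz⟩ := not_isMin_iff.1 hx
  have hne : (s \ {x}).Nonempty := by
    by_contra hemp
    rw [Set.not_nonempty_iff_eq_empty, Set.sdiff_eq_empty] at hemp
    have : z ∈ s := hs.2.2 z hz.le fun w hw => Or.inl ((hemp hw : w = x) ▸ hz.le)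
    exact hz.ne (hemp this)
  -- Since `s` is a chain, this maximal element is the greatest below `x`; maximality of `s` forces
  -- `y ⋖ x`.
  obtain ⟨y, hy⟩ := (Set.toFinite (s \ {x})).exists_maximal hne
  have hyx : y < x := lt_of_le_of_ne (hs.1 hy.1.1) hy.1.2
  have hgreatest : ∀ w ∈ s, w ≠ x → w ≤ y := by
    intro w hw hwx
    rcases hs.2.1.total hw hy.1.1 with h | h
    exacts [h, hy.2 ⟨hw, hwx⟩ h]
  refine ⟨y, ⟨hyx, fun w hyw hwx => ?_⟩, s \ {x}, ⟨?_, ?_, ?_⟩, ?_⟩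
  · have : w ∈ s := hs.2.2 w hwx.le fun v hv => by
      by_cases hvx : v = x
      · exact Or.inl (hvx ▸ hwx.le)
      · exact Or.inr ((hgreatest v hv hvx).trans hyw.le)
    exact hyw.not_ge (hgreatest w this hwx.ne)
  · exact fun w hw => hgreatest w hw.1 hw.2
  · exact hs.2.1.mono Set.sdiff_subset
  · intro w hwy hcomp
    refine ⟨hs.2.2 w (hwy.trans hyx.le) fun v hv => ?_, (hwy.trans_lt hyx).ne⟩
    by_cases hvx : v = x
    · exact Or.inl (hvx ▸ hwy.trans hyx.le)
    · exact hcomp v ⟨hv, hvx⟩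
  · rw [Set.insert_sdiff_singleton, Set.insert_eq_of_mem hxs]

-- Deleting `x` leaves a maximal chain below a unique coatom `y`, recovered as the greatest
-- remaining element.
open Classical in
lemma numMaxChains_eq_sum [Fintype L] {x : L} (hx : ¬ IsMin x) :
    numMaxChains x = ∑ y with y ⋖ x, numMaxChains y := by
  simp only [numMaxChains_eq_ncard, Set.ncard_eq_toFinset_card']
  have hunion : (maxChains x).toFinset = (Finset.univ.filter fun y => y ⋖ x).biUnion
      fun y => (maxChains y).toFinset.image (insert x) := by
    ext s
    simp only [Set.mem_toFinset, Finset.mem_biUnion, Finset.mem_filter, Finset.mem_univ, true_and,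
      Finset.mem_image]
    constructor
    · exact exists_eq_insert_of_mem_maxChains hx
    · rintro ⟨y, hy, u, hu, rfl⟩
      exact insert_mem_maxChains hy hu
  have hinj : ∀ {y y' : L} {u u' : Set L}, y ⋖ x → y' ⋖ x → u ∈ maxChains y → u' ∈ maxChains y' →
      insert x u = insert x u' → u = u' := by
    intro y y' u u' hy hy' hu hu' h
    rw [← Set.insert_sdiff_self_of_notMem (notMem_of_mem_maxChains hy.lt hu), h,
      Set.insert_sdiff_self_of_notMem (notMem_of_mem_maxChains hy'.lt hu')]
  rw [hunion, Finset.card_biUnion]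
  · refine Finset.sum_congr rfl fun y hy => Finset.card_image_of_injOn ?_
    have hy := (Finset.mem_filter.1 hy).2
    intro u hu u' hu' h
    exact hinj hy hy (by simpa using hu) (by simpa using hu') h
  · intro y hy y' hy' hne
    have hy := (Finset.mem_filter.1 hy).2
    have hy' := (Finset.mem_filter.1 hy').2
    refine Finset.disjoint_left.2 fun s hs hs' => hne ?_
    obtain ⟨u, hu, rfl⟩ := Finset.mem_image.1 hs
    obtain ⟨u', hu', h⟩ := Finset.mem_image.1 hs'
    rw [Set.mem_toFinset] at hu hu'
    have := hinj hy hy' hu hu' h.symm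
    subst this
    exact le_antisymm (hu'.1 (top_mem_of_mem_maxChains hu)) (hu.1 (top_mem_of_mem_maxChains hu'))

end Flags

/-! ### Log-supermodular weights and coefficients -/

section MaxChainCount

variable {L : Type*} [DistribLattice L] [Fintype L]

lemma numMaxChains_eq_chainCount (x : L) : numMaxChains x = chainCount (rank x) x := by
  classical
  induction x using WellFoundedLT.induction with
  | ind x ih =>
    by_cases h : IsMin x
    · rw [numMaxChains_eq_ncard, maxChains_of_isMin h, rank_of_isMin h, chainCount,
        Set.ncard_singleton]
    · obtain ⟨y₀, hy₀⟩ := exists_covBy_of_not_isMin h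
      rw [numMaxChains_eq_sum h, rank_of_covBy hy₀, chainCount]
      -- Elements `y < x` not covered by `x` have rank too small to carry a chain of the required
      -- length.
      refine Finset.sum_subset_zero_on_sdiff ?_ ?_ ?_
      · intro y hy
        simp only [Finset.mem_filter, Finset.mem_univ, true_and] at hy ⊢
        exact hy.lt
      · intro y hy
        simp only [Finset.mem_sdiff, Finset.mem_filter, Finset.mem_univ, true_and] at hy
        obtain ⟨z, hyz, hzx⟩ := exists_le_covBy_of_lt hy.1
        have hlt : y < z := lt_of_le_of_ne hyz (by rintro rfl; exact hy.2 hzx)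
        refine chainCount_eq_zero rank_strictMono ?_
        have h₁ := rank_strictMono hlt
        have h₂ := rank_of_covBy hzx
        have h₃ := rank_of_covBy hy₀
        omega
      · intro y hy
        have hy := (Finset.mem_filter.1 hy).2
        rw [ih y hy.lt]
        congr 1
        have h₂ := rank_of_covBy hy
        have h₃ := rank_of_covBy hy₀
        omega

lemma numMaxChains_pos (x : L) : 0 < numMaxChains x := by
  classical
  induction x using WellFoundedLT.induction with
  | ind x ih =>
    by_cases h : IsMin x
    · rw [numMaxChains_eq_ncard, maxChains_of_isMin h, Set.ncard_singleton]
      exact Nat.one_pos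
    · obtain ⟨y, hy⟩ := exists_covBy_of_not_isMin h
      rw [numMaxChains_eq_sum h]
      exact (ih y hy.lt).trans_le
        (Finset.single_le_sum (f := numMaxChains) (fun _ _ => Nat.zero_le _) (by simpa using hy))

/-- Fishburn's inequality. -/
lemma numMaxChains_div_factorial_mul_le (x y : L) :
    (numMaxChains x : ℝ) / (rank x).factorial * ((numMaxChains y : ℝ) / (rank y).factorial)
      ≤ (numMaxChains (x ⊓ y) : ℝ) / (rank (x ⊓ y)).factorial
        * ((numMaxChains (x ⊔ y) : ℝ) / (rank (x ⊔ y)).factorial) := by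
  simp only [numMaxChains_eq_chainCount]
  exact chainCount_div_factorial_mul_le rank_strictMono rank_modular x y

/-- Log-convexity of the factorial, by induction on the common difference `a - c = d - b`. -/
lemma factorial_mul_factorial_le {a b c d : ℕ} (h : a + b = c + d) (hca : c ≤ a) (hcb : c ≤ b) :
    a.factorial * b.factorial ≤ c.factorial * d.factorial := by
  obtain ⟨i, rfl⟩ := Nat.exists_eq_add_of_le hca
  obtain rfl : d = b + i := by omega
  clear h hca
  induction i with
  | zero => simp
  | succ i ih =>
    calc (c + (i + 1)).factorial * b.factorial
        = (c + i + 1) * ((c + i).factorial * b.factorial) := by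
          rw [← add_assoc, Nat.factorial_succ, mul_assoc]
      _ ≤ (b + i + 1) * (c.factorial * (b + i).factorial) := by gcongr
      _ = c.factorial * (b + (i + 1)).factorial := by
          rw [← add_assoc, Nat.factorial_succ]; ring

lemma numMaxChains_mul_le (x y : L) :
    (numMaxChains x : ℝ) * numMaxChains y ≤ numMaxChains (x ⊓ y) * numMaxChains (x ⊔ y) := by
  have hf : ((rank x).factorial : ℝ) * (rank y).factorial
      ≤ (rank (x ⊓ y)).factorial * (rank (x ⊔ y)).factorial := by
    exact_mod_cast factorial_mul_factorial_le (rank_modular x y)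
      (rank_strictMono.monotone inf_le_left) (rank_strictMono.monotone inf_le_right)
  have := mul_le_mul (numMaxChains_div_factorial_mul_le x y) hf (by positivity) (by positivity)
  have hpos : ∀ z : L, ((rank z).factorial : ℝ) ≠ 0 := fun z => by positivity
  have e : ∀ u v : L, (numMaxChains u : ℝ) / (rank u).factorial
      * ((numMaxChains v : ℝ) / (rank v).factorial)
      * (((rank u).factorial : ℝ) * (rank v).factorial) = numMaxChains u * numMaxChains v := by
    intro u v
    have := hpos u
    have := hpos v
    field_simp
  rwa [e, e] at this

/-- The weight of `x` in the polynomials `E`. -/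
def weight {L : Type*} [Preorder L] (μ : L → ℝ) (s t : ℝ) (x : L) : ℝ :=
  μ x * (numMaxChains x : ℝ) ^ t / ((rank x).factorial : ℝ) ^ s

lemma weight_nonneg {L : Type*} [Preorder L] {μ : L → ℝ} (hμ : ∀ x, 0 ≤ μ x) (s t : ℝ) (x : L) : 0 ≤ weight μ s t x := by
  have := hμ x
  unfold weight
  positivity

lemma weight_eq (μ : L → ℝ) (s t : ℝ) (x : L) :
    weight μ s t x = μ x * (((numMaxChains x : ℝ) / (rank x).factorial) ^ s
      * (numMaxChains x : ℝ) ^ (t - s)) := by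
  have hm : (0 : ℝ) < numMaxChains x := by exact_mod_cast numMaxChains_pos x
  rw [weight, Real.div_rpow hm.le (by positivity), div_mul_eq_mul_div, ← Real.rpow_add hm,
    add_sub_cancel, mul_div_assoc]

lemma weight_logSupermodular {μ : L → ℝ} (hμ_nonneg : ∀ x, 0 ≤ μ x) (hμ : LogSupermodular μ)
    {s t : ℝ} (hs : 0 ≤ s) (hst : s ≤ t) : LogSupermodular (weight μ s t) := by
  intro x y
  simp only [weight_eq]
  have h₁ := Real.rpow_le_rpow (by positivity) (numMaxChains_div_factorial_mul_le x y) hs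
  have h₂ := Real.rpow_le_rpow (by positivity) (numMaxChains_mul_le x y) (sub_nonneg.2 hst)
  rw [Real.mul_rpow (by positivity) (by positivity),
    Real.mul_rpow (by positivity) (by positivity)] at h₁ h₂
  have h₃ := mul_le_mul (hμ x y) (mul_le_mul h₁ h₂ (by positivity) (by positivity))
    (by positivity) (mul_nonneg (hμ_nonneg _) (hμ_nonneg _))
  linarith

lemma E_eq_sum_weight (μ : L → ℝ) (s t : ℝ) (k : L → ℝ) :
    E μ s t k = ∑ x, C (k x * weight μ s t x) * X ^ rank x := by
  simp only [E, weight, mul_assoc, mul_div_assoc]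

lemma coeff_E_mul_E (μ : L → ℝ) (s t : ℝ) (k l : L → ℝ) (n : ℕ) :
    (E μ s t k * E μ s t l).coeff n = ∑ p : L × L,
      if rank p.1 + rank p.2 = n then (k p.1 * weight μ s t p.1) * (l p.2 * weight μ s t p.2)
      else 0 := by
  simp only [E_eq_sum_weight]
  rw [Finset.sum_mul_sum, ← Finset.sum_product', Finset.univ_product_univ,
    Polynomial.finsetSum_coeff]
  refine Finset.sum_congr rfl fun p _ => ?_
  rw [mul_mul_mul_comm, ← C_mul, ← pow_add, coeff_C_mul_X_pow]
  simp only [eq_comm]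

/-- A pointwise four functions condition gives a coefficientwise inequality. -/
lemma coeffLE_of_forall_mul_le {μ : L → ℝ} (hμ_nonneg : ∀ x, 0 ≤ μ x) (hμ : LogSupermodular μ)
    {s t : ℝ} (hs : 0 ≤ s) (hst : s ≤ t) {f₁ f₂ f₃ f₄ : L → ℝ} (h₁ : ∀ x, 0 ≤ f₁ x)
    (h₂ : ∀ x, 0 ≤ f₂ x) (h₃ : ∀ x, 0 ≤ f₃ x) (h₄ : ∀ x, 0 ≤ f₄ x)
    (h : ∀ x y, f₁ x * f₂ y ≤ f₃ (x ⊓ y) * f₄ (x ⊔ y)) :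
    CoeffLE (E μ s t f₁ * E μ s t f₂) (E μ s t f₃ * E μ s t f₄) := by
  intro n
  have hw := weight_nonneg hμ_nonneg s t
  rw [coeff_sub, sub_nonneg, coeff_E_mul_E, coeff_E_mul_E]
  refine sum_rank_eq_le rank_modular (α := fun x => f₁ x * weight μ s t x)
    (β := fun x => f₂ x * weight μ s t x) (γ := fun x => f₃ x * weight μ s t x)
    (δ := fun x => f₄ x * weight μ s t x) (fun x => mul_nonneg (h₁ x) (hw x))
    (fun x => mul_nonneg (h₂ x) (hw x)) (fun x => mul_nonneg (h₃ x) (hw x))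
    (fun x => mul_nonneg (h₄ x) (hw x)) (fun x y => ?_) n
  have := mul_le_mul (h x y) (weight_logSupermodular hμ_nonneg hμ hs hst x y)
    (mul_nonneg (hw _) (hw _)) (mul_nonneg (h₃ _) (h₄ _))
  linarith

end MaxChainCount

end QFKG

end

theorem theorem5p3 {L : Type*} [DistribLattice L] [Fintype L]
    (μ : L → ℝ) (hμ_nonneg : ∀ x, 0 ≤ μ x) (hμ : QFKG.LogSupermodular μ)
    (s t : ℝ) (hs : 0 ≤ s) (hst : s ≤ t)
    (g h : L → ℝ) (hg : ∀ x, 0 ≤ g x) (hh : ∀ x, 0 ≤ h x) :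
    (QFKG.Comonotone g h →
      QFKG.CoeffLE (QFKG.E μ s t g * QFKG.E μ s t h)
        (QFKG.E μ s t (fun _ => 1) * QFKG.E μ s t (fun x => g x * h x))) ∧
    (QFKG.Countermonotone g h →
      QFKG.CoeffLE (QFKG.E μ s t (fun _ => 1) * QFKG.E μ s t (fun x => g x * h x))
        (QFKG.E μ s t g * QFKG.E μ s t h)) := by
  have hgh : ∀ x, 0 ≤ g x * h x := fun x => mul_nonneg (hg x) (hh x)
  have h1 : ∀ x : L, (0 : ℝ) ≤ (fun _ => 1) x := fun _ => zero_le_one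
  refine ⟨?_, ?_⟩
  · rintro (⟨mg, mh⟩ | ⟨mg, mh⟩)
    · refine QFKG.coeffLE_of_forall_mul_le hμ_nonneg hμ hs hst hg hh h1 hgh fun x y => ?_
      rw [one_mul]
      -- Both increasing: compare at the join. In the decreasing case the product moves to the meet.
      exact mul_le_mul (mg le_sup_left) (mh le_sup_right) (hh _) (hg _)
    · rw [mul_comm (QFKG.E μ s t fun _ => 1)]
      refine QFKG.coeffLE_of_forall_mul_le hμ_nonneg hμ hs hst hg hh hgh h1 fun x y => ?_
      rw [mul_one]
      exact mul_le_mul (mg inf_le_left) (mh inf_le_right) (hh _) (hg _)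
  · rintro (⟨mg, mh⟩ | ⟨mg, mh⟩)
    · rw [mul_comm (QFKG.E μ s t g)]
      -- The decreasing function is evaluated at the meet and the increasing one at the join, so
      -- both grow from their values at `y`.
      refine QFKG.coeffLE_of_forall_mul_le hμ_nonneg hμ hs hst h1 hgh hh hg fun x y => ?_
      rw [one_mul, mul_comm (g y)]
      exact mul_le_mul (mh inf_le_right) (mg le_sup_right) (hg _) (hh _)
    · refine QFKG.coeffLE_of_forall_mul_le hμ_nonneg hμ hs hst h1 hgh hg hh fun x y => ?_
      rw [one_mul]
      exact mul_le_mul (mg inf_le_right) (mh le_sup_right) (hh _) (hg _)
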